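/- Let $h_1,\dots,h_s\in\mathbb{R}^d$ generate a dense additive subgroup of $\mathbb{R}^d$. For a complex-valued distribution $f$ on $\mathbb{R}^d$ and $h\in\mathbb{R}^d$, let $\tau_h f$ be the translated distribution $(\tau_h f)(\varphi)=f(\varphi(\cdot-h))$, which corresponds to $(\tau_h f)(x)=f(x+h)$ for ordinary functions. Let $f$ be a complex-valued distribution on $\mathbb{R}^d$ for which there are natural numbers $n_1,\dots,n_s$ with $$\dim_{\mathbb{C}} \operatorname{span}\{f,\tau_{h_i}f,\dots,(\tau_{h_i})^{n_i}f\}\le n_i,\qquad i=1,\dots,s.$$ Then $f$ is, in the distributional sense, a continuous exponential polynomial. That is, there is a (continuous) function $g:\mathbb{R}^d\to\mathbb{C}$ of the form $g(x)=\sum_{k=1}^m p_k(x)\,e^{\langle \lambda_k,x\rangle}$, with complex polynomials $p_k$ in $d$ variables, $\lambda_k\in\mathbb{C}^d$ and $\langle\lambda,x\rangle=\sum_{j=1}^d\lambda_j x_j$, such that $f(\varphi)=\int_{\mathbb{R}^d}\varphi(x)g(x)\,dx$ for every test function $\varphi$. In particular, $f$ is an ordinary function that equals an exponential polynomial almost everywhere: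 every locally integrable function $u:\mathbb{R}^d\to\mathbb{C}$ with $f(\varphi)=\int_{\mathbb{R}^d}\varphi(x)u(x)\,dx$ for every test function $\varphi$ equals $g$ almost everywhere with respect to Lebesgue measure. -/

import Mathlib

open MeasureTheory TopologicalSpace
open scoped Distributions

noncomputable section

/-- The test function `φ(· - h)` on `ℝ^d`. -/
def translateTest {d : ℕ} (h : EuclideanSpace ℝ (Fin d))
    (φ : 𝓓((⊤ : Opens (EuclideanSpace ℝ (Fin d))), ℝ)) :
    𝓓((⊤ : Opens (EuclideanSpace ℝ (Fin d))), ℝ) where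
  toFun x := φ (x - h)
  contDiff' := φ.contDiff.comp (contDiff_id.sub contDiff_const)
  hasCompactSupport' := φ.hasCompactSupport.comp_homeomorph (Homeomorph.subRight h)
  tsupport_subset' := fun _ _ => trivial

theorem translateTest_apply {d : ℕ} (h : EuclideanSpace ℝ (Fin d))
    (φ : 𝓓((⊤ : Opens (EuclideanSpace ℝ (Fin d))), ℝ)) (x : EuclideanSpace ℝ (Fin d)) :
    translateTest h φ x = φ (x - h) := rfl

/-- `φ ↦ φ(· - h)` as a continuous linear map from the smooth functions supported in the compact
set `K` to those supported in `K + h`. -/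
def translateSupportedIn {d : ℕ} (h : EuclideanSpace ℝ (Fin d))
    (K : Compacts (EuclideanSpace ℝ (Fin d))) :
    𝓓_{K}(EuclideanSpace ℝ (Fin d), ℝ) →L[ℝ]
      𝓓_{K.map (fun x => x + h) (by fun_prop)}(EuclideanSpace ℝ (Fin d), ℝ) :=
  ContDiffMapSupportedIn.mkCLM ℝ (fun φ x => φ (x - h))
    (fun _ _ _ => rfl) (fun _ _ _ => rfl)
    (fun φ => φ.contDiff.comp (contDiff_id.sub contDiff_const))
    (fun φ x hx => φ.zero_on_compl (fun hK => hx ⟨x - h, hK, sub_add_cancel x h⟩))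
    (fun i _ => ⟨{i}, 1, zero_le_one, fun φ x _ => by
      rw [iteratedFDeriv_comp_sub, Finset.sup_singleton, one_mul]
      exact ContDiffMapSupportedIn.norm_iteratedFDeriv_apply_le_seminorm_top ℝ⟩)

/-- `φ ↦ φ(· - h)` as a continuous linear map of the space of test functions on `ℝ^d`. -/
def translateTestCLM {d : ℕ} (h : EuclideanSpace ℝ (Fin d)) :
    𝓓((⊤ : Opens (EuclideanSpace ℝ (Fin d))), ℝ) →L[ℝ]
      𝓓((⊤ : Opens (EuclideanSpace ℝ (Fin d))), ℝ) :=
  TestFunction.mkCLM ℝ (translateTest h) (fun _ _ => rfl) (fun _ _ => rfl)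
    (fun K _ => (TestFunction.continuous_ofSupportedIn
      (K := K.map (fun x => x + h) (by fun_prop))
      (Ω := (⊤ : Opens (EuclideanSpace ℝ (Fin d)))) (fun _ _ => trivial)).comp
        (translateSupportedIn h K).continuous)

/-- The translation operator `τ_h` on complex-valued distributions on `ℝ^d`:
`(τ_h f)(φ) = f(φ(· - h))`. It extends `(τ_h f)(x) = f(x + h)` for ordinary functions. -/
def distTranslate {d : ℕ} (h : EuclideanSpace ℝ (Fin d))
    (f : 𝓓'((⊤ : Opens (EuclideanSpace ℝ (Fin d))), ℂ)) :
    𝓓'((⊤ : Opens (EuclideanSpace ℝ (Fin d))), ℂ) :=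
  ContinuousLinearMap.precompCompactConvergenceCLM ℂ (translateTestCLM h) f

theorem distTranslate_apply {d : ℕ} (h : EuclideanSpace ℝ (Fin d))
    (f : 𝓓'((⊤ : Opens (EuclideanSpace ℝ (Fin d))), ℂ))
    (φ : 𝓓((⊤ : Opens (EuclideanSpace ℝ (Fin d))), ℝ)) :
    distTranslate h f φ = f (translateTest h φ) := rfl

/-- The distribution `f` is the locally integrable function `u`:
`f(φ) = ∫ φ(x) u(x) dx` for all test functions `φ`. -/
def IsGivenByFunction {d : ℕ} (f : 𝓓'((⊤ : Opens (EuclideanSpace ℝ (Fin d))), ℂ))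
    (u : EuclideanSpace ℝ (Fin d) → ℂ) : Prop :=
  LocallyIntegrable u volume ∧
    ∀ φ : 𝓓((⊤ : Opens (EuclideanSpace ℝ (Fin d))), ℝ), f φ = ∫ x, (φ x : ℂ) * u x

/-- Exponential polynomials on `ℝ^d`: finite sums `∑_k p_k(x) exp(⟨l_k, x⟩)` with `p_k` a complex
polynomial in `d` variables and `l_k ∈ ℂ^d`. -/
def IsExponentialPolynomial {d : ℕ} (g : EuclideanSpace ℝ (Fin d) → ℂ) : Prop :=
  ∃ (m : ℕ) (p : Fin m → MvPolynomial (Fin d) ℂ) (l : Fin m → Fin d → ℂ),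
    ∀ x : EuclideanSpace ℝ (Fin d),
      g x = ∑ k, MvPolynomial.eval (fun j => (x j : ℂ)) (p k) *
        Complex.exp (∑ j, l k j * (x j : ℂ))

end

/-! A linear dependence among the iterates gives nonzero polynomials `P_i` with `P_i(τ_{h_i}) f =
0`. As the translations commute, `f` lies in a finite-dimensional space `W` stable under every
`τ_{h_i}` (`exists_finiteDimensional_invariant`), hence under the subgroup they generate. Since `x ↦
f(φ(· - x))` is continuous and `W` is closed for pointwise convergence, density puts all translates
of `f` in `W`.

The span of the translates is thus a finite-dimensional continuous representation of `ℝ^d`. Its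
matrix coefficients are exponential polynomials: one-parameter groups of matrices are
differentiable, and the resulting linear ODEs are solved on generalized eigenspaces. Hence all
functions `x ↦ f(φ(· - x))` lie in one finite-dimensional space `G` of exponential polynomials.

Letting `φ` run through an approximate identity makes these functions converge to `f` as
functionals. The functionals given by elements of `G` form a finite-dimensional, hence closed,
space, so `f` itself is given by an element of `G`. -/

/-! ### Convolution of distributions with test functions -/

section TestFunctionConvolution

open scoped Convolution BoundedContinuousFunction ContDiff Pointwise

/-- Differentiating a convolution with a continuous compactly supported function. -/
theorem iteratedFDeriv_convolution_smul {E F : Type*} [NormedAddCommGroup E] [NormedSpace ℝ E]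
    [MeasurableSpace E] [BorelSpace E] {μ : Measure E} [SFinite μ] [μ.IsAddLeftInvariant]
    [NormedAddCommGroup F] [NormedSpace ℝ F]
    {ψ : E → ℝ} {g : E → F} (hψ : LocallyIntegrable ψ μ)
    (hg : ContDiff ℝ ∞ g) (hgc : HasCompactSupport g) (n : ℕ) :
    iteratedFDeriv ℝ n (ψ ⋆[ContinuousLinearMap.lsmul ℝ ℝ, μ] g) =
      ψ ⋆[ContinuousLinearMap.lsmul ℝ ℝ, μ] iteratedFDeriv ℝ n g := by
  induction n with
  | zero =>
    ext1 x
    rw [iteratedFDeriv_zero_eq_comp, iteratedFDeriv_zero_eq_comp]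
    simp only [Function.comp_apply, convolution_lsmul]
    rw [← LinearIsometryEquiv.coe_toContinuousLinearEquiv,
      ← ContinuousLinearEquiv.integral_comp_comm]
    simp
  | succ n ih =>
    ext1 x
    rw [iteratedFDeriv_succ_eq_comp_left, iteratedFDeriv_succ_eq_comp_left, ih]
    have hd : ContDiff ℝ 1 (iteratedFDeriv ℝ n g) := hg.iteratedFDeriv_right (by exact_mod_cast le_top)
    have h := (hgc.iteratedFDeriv (𝕜 := ℝ) n).hasFDerivAt_convolution_right
      (ContinuousLinearMap.lsmul ℝ ℝ) hψ hd x
    simp only [Function.comp_apply, convolution_lsmul, h.fderiv]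
    rw [convolution_def]
    exact (ContinuousLinearEquiv.integral_comp_comm (μ := μ) (𝕜 := ℝ)
      (E := E →L[ℝ] E [×n]→L[ℝ] F) (F := E [×(n + 1)]→L[ℝ] F) (continuousMultilinearCurryLeftEquiv ℝ
        (fun _ : Fin (n + 1) => E) F).symm.toContinuousLinearEquiv _).symm

section Jets

variable {E : Type*} [NormedAddCommGroup E] [NormedSpace ℝ E]

/-- The derivative of order `i` of a test function as a bounded continuous function. -/
noncomputable def testJet (i : ℕ) (φ : 𝓓((⊤ : Opens E), ℝ)) : E →ᵇ (E [×i]→L[ℝ] ℝ) :=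
  BoundedContinuousFunction.ofNormedAddCommGroup (iteratedFDeriv ℝ i φ)
    (φ.contDiff.continuous_iteratedFDeriv (by exact_mod_cast le_top))
    _ ((φ.contDiff.continuous_iteratedFDeriv (m := i) (by exact_mod_cast le_top)
      |>.bounded_above_of_compact_support (φ.hasCompactSupport.iteratedFDeriv i)).choose_spec)

variable (E) in
/-- Finite families of derivatives, of the orders in `s`, with the supremum norm. -/
def JetSpace (s : Finset ℕ) : Type _ := ∀ i : s, E →ᵇ (E [×(i : ℕ)]→L[ℝ] ℝ)

noncomputable instance (s : Finset ℕ) : NormedAddCommGroup (JetSpace E s) :=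
  inferInstanceAs (NormedAddCommGroup (∀ i : s, E →ᵇ (E [×(i : ℕ)]→L[ℝ] ℝ)))

noncomputable instance (s : Finset ℕ) : NormedSpace ℝ (JetSpace E s) :=
  inferInstanceAs (NormedSpace ℝ (∀ i : s, E →ᵇ (E [×(i : ℕ)]→L[ℝ] ℝ)))

instance (s : Finset ℕ) : CompleteSpace (JetSpace E s) :=
  inferInstanceAs (CompleteSpace (∀ i : s, E →ᵇ (E [×(i : ℕ)]→L[ℝ] ℝ)))

/-- The derivatives of a test function of the orders in `s`. -/
noncomputable def testJets (s : Finset ℕ) (φ : 𝓓((⊤ : Opens E), ℝ)) : JetSpace E s :=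
  fun i => testJet i φ

/-- The component of order `i` of a family of derivatives, evaluated at `x`. -/
noncomputable def JetSpace.evalCLM {s : Finset ℕ} (i : s) (x : E) :
    JetSpace E s →L[ℝ] (E [×(i : ℕ)]→L[ℝ] ℝ) :=
  (BoundedContinuousFunction.evalCLM ℝ x).comp
    (ContinuousLinearMap.proj (R := ℝ) (φ := fun i : s => E →ᵇ (E [×(i : ℕ)]→L[ℝ] ℝ)) i)

theorem JetSpace.ext_eval {s : Finset ℕ} {a b : JetSpace E s}
    (h : ∀ i x, evalCLM i x a = evalCLM i x b) : a = b :=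
  funext fun i => BoundedContinuousFunction.ext (h i)

@[simp]
theorem testJet_apply (i : ℕ) (φ : 𝓓((⊤ : Opens E), ℝ)) (x : E) :
    testJet i φ x = iteratedFDeriv ℝ i φ x := rfl

/-- On test functions supported in a fixed compact set, a real continuous functional factors
through finitely many derivatives. -/
theorem exists_real_functional_testJet (f : 𝓓((⊤ : Opens E), ℝ) →L[ℝ] ℝ) (K : Compacts E) :
    ∃ (s : Finset ℕ) (Λ : JetSpace E s →L[ℝ] ℝ),
      ∀ φ : 𝓓((⊤ : Opens E), ℝ), tsupport φ ⊆ K → f φ = Λ (testJets s φ) := by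
  let ι := TestFunction.ofSupportedInCLM (E := E) (F := ℝ) (n := ⊤) ℝ (K := K) (Ω := ⊤) (fun _ _ => trivial)
  let f' : 𝓓_{K}(E, ℝ) →L[ℝ] ℝ := f.comp ι
  obtain ⟨s, C, -, hC⟩ := Seminorm.bound_of_continuous
    (ContDiffMapSupportedIn.withSeminorms ℝ E ℝ ⊤ K)
    ((normSeminorm ℝ ℝ).comp f'.toLinearMap) (continuous_norm.comp f'.continuous)
  let J : 𝓓_{K}(E, ℝ) →ₗ[ℝ] JetSpace E s :=
    LinearMap.pi (φ := fun i : s => E →ᵇ (E [×(i : ℕ)]→L[ℝ] ℝ))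
      fun i => ContDiffMapSupportedIn.structureMapLM ℝ ⊤ i
  have hJ : ∀ φ, ‖f' φ‖ ≤ C * ‖J φ‖ := fun φ => by
    have h1 := hC φ
    have h2 : (s.sup (ContDiffMapSupportedIn.seminorm ℝ E ℝ ⊤ K)) φ ≤ ‖J φ‖ := by
      refine Seminorm.finset_sup_apply_le (norm_nonneg _) fun i hi => ?_
      exact norm_le_pi_norm (G := fun i : s => E →ᵇ (E [×(i : ℕ)]→L[ℝ] ℝ)) (J φ) ⟨i, hi⟩
    exact h1.trans (mul_le_mul_of_nonneg_left h2 C.2)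
  -- By the bound `hJ`, `f'` factors through the range of `J` as a bounded functional, which
  -- Hahn–Banach extends to all jets.
  have hker : LinearMap.ker J ≤ LinearMap.ker f'.toLinearMap := fun φ hφ => by
    have := hJ φ
    rw [LinearMap.mem_ker.1 hφ, norm_zero, mul_zero] at this
    exact norm_le_zero_iff.1 this
  let e := J.quotKerEquivRange
  let g : LinearMap.range J →ₗ[ℝ] ℝ :=
    ((LinearMap.ker J).liftQ f'.toLinearMap hker) ∘ₗ e.symm.toLinearMap
  have hg : ∀ φ, g ⟨J φ, φ, rfl⟩ = f' φ := fun φ => by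
    have : e.symm ⟨J φ, φ, rfl⟩ = (LinearMap.ker J).mkQ φ := by
      rw [LinearEquiv.symm_apply_eq]; rfl
    simp only [g, LinearMap.comp_apply, LinearEquiv.coe_coe, this]
    rfl
  obtain ⟨Λ, hΛ, -⟩ := exists_extension_norm_eq (𝕜 := ℝ) (LinearMap.range J)
    (g.mkContinuous C (by rintro ⟨_, φ, rfl⟩; rw [hg]; exact hJ φ))
  refine ⟨s, Λ, fun φ hφ => ?_⟩
  let φK : 𝓓_{K}(E, ℝ) := .of_support_subset φ.contDiff (subset_closure.trans hφ)
  have h1 : f φ = f' φK := rfl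
  have h2 : testJets s φ = J φK := by
    refine JetSpace.ext_eval fun i x => ?_
    have := congrFun (ContDiffMapSupportedIn.structureMapLM_top_apply ℝ (i := i) φK) x
    exact this.symm
  rw [h1, h2, ← hg]
  exact (hΛ ⟨J φK, φK, rfl⟩).symm

end Jets

section Translate

variable {d : ℕ}

local notation "V" => EuclideanSpace ℝ (Fin d)

theorem iteratedFDeriv_translateTest (h : V) (φ : 𝓓((⊤ : Opens V), ℝ)) (i : ℕ) (x : V) :
    iteratedFDeriv ℝ i (translateTest h φ) x = iteratedFDeriv ℝ i φ (x - h) :=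
  iteratedFDeriv_comp_sub i h x

/-- A compactly supported continuous derivative is uniformly continuous, so its translates vary
continuously in supremum norm. -/
theorem continuous_testJet_translateTest (i : ℕ) (φ : 𝓓((⊤ : Opens V), ℝ)) :
    Continuous fun h : V => testJet i (translateTest h φ) := by
  have hc := φ.contDiff.continuous_iteratedFDeriv (m := i) (by exact_mod_cast le_top)
  have hu := (φ.hasCompactSupport.iteratedFDeriv (𝕜 := ℝ) i).uniformContinuous_of_continuous hc
  rw [Metric.continuous_iff]
  intro b ε hε
  obtain ⟨δ, hδ, H⟩ := Metric.uniformContinuous_iff.1 hu (ε / 2) (by positivity)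
  refine ⟨δ, hδ, fun a hab => lt_of_le_of_lt ?_ (half_lt_self hε)⟩
  refine (BoundedContinuousFunction.dist_le (by positivity)).2 fun x => ?_
  simp only [testJet_apply, iteratedFDeriv_translateTest]
  refine (H ?_).le
  rwa [dist_sub_left]

theorem continuous_testJets_translateTest (s : Finset ℕ) (φ : 𝓓((⊤ : Opens V), ℝ)) :
    Continuous fun h : V => testJets s (translateTest h φ) :=
  continuous_pi fun i => continuous_testJet_translateTest i φ

/-- The convolution of two test functions. -/
noncomputable def convTest (ψ φ : 𝓓((⊤ : Opens V), ℝ)) : 𝓓((⊤ : Opens V), ℝ) where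
  toFun := ψ ⋆[ContinuousLinearMap.lsmul ℝ ℝ, volume] φ
  contDiff' := φ.hasCompactSupport.contDiff_convolution_right _
    (ψ.continuous.locallyIntegrable) φ.contDiff
  hasCompactSupport' := ψ.hasCompactSupport.convolution _ φ.hasCompactSupport
  tsupport_subset' := fun _ _ => trivial

theorem convTest_comm (ψ φ : 𝓓((⊤ : Opens V), ℝ)) : convTest ψ φ = convTest φ ψ := by
  ext x
  change (ψ ⋆[ContinuousLinearMap.lsmul ℝ ℝ, volume] φ) x =
    (φ ⋆[ContinuousLinearMap.lsmul ℝ ℝ, volume] ψ) x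
  rw [← convolution_flip]
  congr 1
  ext
  simp

/-- For `h` near `h₀` the translates are supported in one compact set, where `f` is a continuous
functional of finitely many derivatives. -/
theorem continuous_real_functional_translateTest (f : 𝓓((⊤ : Opens V), ℝ) →L[ℝ] ℝ)
    (φ : 𝓓((⊤ : Opens V), ℝ)) : Continuous fun h : V => f (translateTest h φ) := by
  rw [continuous_iff_continuousAt]
  intro h₀
  obtain ⟨s, Λ, hΛ⟩ := exists_real_functional_testJet f
    ⟨tsupport φ + Metric.closedBall h₀ 1, φ.hasCompactSupport.isCompact.add
      (isCompact_closedBall h₀ 1)⟩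
  have hc : Continuous fun h : V => Λ (testJets s (translateTest h φ)) :=
    Λ.continuous.comp (continuous_testJets_translateTest s φ)
  refine hc.continuousAt.congr ?_
  filter_upwards [Metric.closedBall_mem_nhds h₀ one_pos] with h hh
  refine (hΛ _ ?_).symm
  refine closure_minimal (fun x hx => ?_) (φ.hasCompactSupport.isCompact.add
      (isCompact_closedBall h₀ 1)).isClosed
  exact ⟨x - h, subset_closure hx, h, hh, sub_add_cancel x h⟩

/-- Through `Λ` the claim becomes the exchange of a bounded functional with a Bochner integral in
the Banach space of jets; evaluating that integral pointwise identifies it with the jets of the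
convolution. -/
theorem integral_mul_real_functional_translateTest (f : 𝓓((⊤ : Opens V), ℝ) →L[ℝ] ℝ)
    (ψ φ : 𝓓((⊤ : Opens V), ℝ)) :
    ∫ h, ψ h * f (translateTest h φ) = f (convTest ψ φ) := by
  have hK := φ.hasCompactSupport.isCompact.add ψ.hasCompactSupport.isCompact
  obtain ⟨s, Λ, hΛ⟩ := exists_real_functional_testJet f ⟨tsupport φ + tsupport ψ, hK⟩
  have h1 : ∀ h : V, ψ h * f (translateTest h φ) =
      Λ (ψ h • testJets s (translateTest h φ)) := fun h => by
    by_cases hh : ψ h = 0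
    · simp [hh]
    · rw [map_smul, smul_eq_mul, hΛ]
      refine closure_minimal (fun x hx => ?_) hK.isClosed
      exact ⟨x - h, subset_closure hx, h, subset_closure hh, sub_add_cancel x h⟩
  have hc : Continuous fun h : V => ψ h • testJets s (translateTest h φ) :=
    ψ.continuous.smul (continuous_testJets_translateTest s φ)
  have hint : Integrable (fun h : V => ψ h • testJets s (translateTest h φ)) :=
    hc.integrable_of_hasCompactSupport ψ.hasCompactSupport.smul_right
  simp_rw [h1]
  rw [ContinuousLinearMap.integral_comp_comm Λ hint, hΛ (convTest ψ φ)]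
  · congr 1
    refine JetSpace.ext_eval fun i x => ?_
    have h2 := (JetSpace.evalCLM i x).integral_comp_comm hint
    have h3 := congrFun (iteratedFDeriv_convolution_smul (μ := (volume : Measure V))
      ψ.continuous.locallyIntegrable φ.contDiff φ.hasCompactSupport i) x
    refine h2.symm.trans (Eq.trans ?_ h3.symm)
    rw [convolution_lsmul]
    congr 1
    ext1 h
    exact congrArg (ψ h • ·) (iteratedFDeriv_translateTest h φ i x)
  · refine closure_minimal ?_ hK.isClosed
    refine (support_convolution_subset _).trans ?_
    rw [add_comm]
    exact Set.add_subset_add subset_closure subset_closure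

theorem continuous_distribution_translateTest (f : 𝓓'((⊤ : Opens V), ℂ))
    (φ : 𝓓((⊤ : Opens V), ℝ)) : Continuous fun h : V => f (translateTest h φ) := by
  let f₀ : 𝓓((⊤ : Opens V), ℝ) →L[ℝ] ℂ := f
  have hr := continuous_real_functional_translateTest (Complex.reCLM.comp f₀) φ
  have hi := continuous_real_functional_translateTest (Complex.imCLM.comp f₀) φ
  have := (Complex.continuous_ofReal.comp hr).add
    ((Complex.continuous_ofReal.comp hi).mul (continuous_const (y := Complex.I)))
  exact this.congr fun h => Complex.re_add_im _

/-- Integrating the translates of a test function against `ψ` commutes with a distribution. -/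
theorem integral_mul_distribution_translateTest (f : 𝓓'((⊤ : Opens V), ℂ))
    (ψ φ : 𝓓((⊤ : Opens V), ℝ)) :
    ∫ h, (ψ h : ℂ) * f (translateTest h φ) = f (convTest ψ φ) := by
  let f₀ : 𝓓((⊤ : Opens V), ℝ) →L[ℝ] ℂ := f
  have hr := integral_mul_real_functional_translateTest (Complex.reCLM.comp f₀) ψ φ
  have hi := integral_mul_real_functional_translateTest (Complex.imCLM.comp f₀) ψ φ
  have hint : Integrable fun h : V => (ψ h : ℂ) * f (translateTest h φ) :=
    ((Complex.continuous_ofReal.comp ψ.continuous).mul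
      (continuous_distribution_translateTest f φ)).integrable_of_hasCompactSupport
      (ψ.hasCompactSupport.comp_left Complex.ofReal_zero).mul_right
  apply Complex.ext
  · rw [← Complex.reCLM_apply, ← ContinuousLinearMap.integral_comp_comm _ hint]
    simp only [Complex.reCLM_apply, Complex.re_ofReal_mul]
    exact hr
  · rw [← Complex.imCLM_apply, ← ContinuousLinearMap.integral_comp_comm _ hint]
    simp only [Complex.imCLM_apply, Complex.im_ofReal_mul]
    exact hi

end Translate

end TestFunctionConvolution

/-! ### The algebra of exponential polynomials -/

section ExponentialPolynomial

variable {d : ℕ}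

local notation "V" => EuclideanSpace ℝ (Fin d)

namespace IsExponentialPolynomial

theorem of_fintype_sum {ι : Type*} [Fintype ι] {g : V → ℂ} (p : ι → MvPolynomial (Fin d) ℂ)
    (l : ι → Fin d → ℂ)
    (hg : ∀ x : V, g x = ∑ k, MvPolynomial.eval (fun j => (x j : ℂ)) (p k) *
      Complex.exp (∑ j, l k j * (x j : ℂ))) : IsExponentialPolynomial g :=
  ⟨Fintype.card ι, p ∘ (Fintype.equivFin ι).symm, l ∘ (Fintype.equivFin ι).symm, fun x => by
    rw [hg, ← (Fintype.equivFin ι).symm.sum_comp]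
    rfl⟩

theorem const (c : ℂ) : IsExponentialPolynomial (fun _ : V => c) :=
  of_fintype_sum (ι := Unit) (fun _ => MvPolynomial.C c) 0 fun x => by simp

theorem add {f g : V → ℂ} (hf : IsExponentialPolynomial f) (hg : IsExponentialPolynomial g) :
    IsExponentialPolynomial (fun x => f x + g x) := by
  obtain ⟨m, p, l, hf⟩ := hf
  obtain ⟨n, q, r, hg⟩ := hg
  exact of_fintype_sum (ι := Fin m ⊕ Fin n) (Sum.elim p q) (Sum.elim l r) fun x => by
    simp [hf, hg]

theorem mul {f g : V → ℂ} (hf : IsExponentialPolynomial f) (hg : IsExponentialPolynomial g) :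
    IsExponentialPolynomial (fun x => f x * g x) := by
  obtain ⟨m, p, l, hf⟩ := hf
  obtain ⟨n, q, r, hg⟩ := hg
  refine of_fintype_sum (ι := Fin m × Fin n) (fun k => p k.1 * q k.2) (fun k => l k.1 + r k.2)
    fun x => ?_
  rw [hf, hg, Finset.sum_mul_sum, ← Finset.sum_product']
  refine Finset.sum_congr rfl fun k _ => ?_
  simp only [map_mul, Pi.add_apply, add_mul, Finset.sum_add_distrib, Complex.exp_add]
  ring

theorem sum {ι : Type*} (s : Finset ι) {f : ι → V → ℂ}
    (hf : ∀ i ∈ s, IsExponentialPolynomial (f i)) :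
    IsExponentialPolynomial (fun x => ∑ i ∈ s, f i x) := by
  classical
  induction s using Finset.induction_on with
  | empty => simpa using const 0
  | insert a s ha ih =>
    simp only [Finset.sum_insert ha]
    exact (hf a (Finset.mem_insert_self a s)).add
      (ih fun i hi => hf i (Finset.mem_insert_of_mem hi))

theorem polynomial_mul_exp (j : Fin d) (p : Polynomial ℂ) (μ : ℂ) :
    IsExponentialPolynomial (fun x : V => p.eval (x j : ℂ) * Complex.exp (μ * (x j : ℂ))) := by
  classical
  refine of_fintype_sum (ι := Unit) (fun _ => Polynomial.aeval (MvPolynomial.X j) p)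
    (fun _ => Pi.single j μ) fun x => ?_
  have h1 : MvPolynomial.eval (fun j => (x j : ℂ)) (Polynomial.aeval (MvPolynomial.X j) p) =
      p.eval (x j : ℂ) := by
    rw [← MvPolynomial.coe_aeval_eq_eval, RingHom.coe_coe, ← Polynomial.aeval_algHom_apply,
      MvPolynomial.aeval_X, Polynomial.coe_aeval_eq_eval]
  simp [h1, Pi.single_apply]

end IsExponentialPolynomial

end ExponentialPolynomial

/-! ### One-parameter groups and linear differential equations -/

/-- A continuous one-parameter group in a Banach algebra is differentiable. -/
theorem exists_hasDerivAt_of_continuous_oneParameter {A : Type*} [NormedRing A] [NormedAlgebra ℝ A]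
    [CompleteSpace A] {m : ℝ → A} (hm : Continuous m) (h0 : m 0 = 1)
    (hadd : ∀ s t, m (s + t) = m s * m t) : ∃ a : A, ∀ t, HasDerivAt m (m t * a) t := by
  let F : ℝ → A := fun u => ∫ s in (0 : ℝ)..u, m s
  have hF : ∀ u, HasDerivAt F (m u) u := fun u => hm.integral_hasStrictDerivAt 0 u |>.hasDerivAt
  -- `F ε / ε` tends to `m 0 = 1` and units form an open set, so `F ε` is invertible for some small
  -- `ε ≠ 0`.
  obtain ⟨ε, hε⟩ : ∃ ε : ℝ, IsUnit (F ε) := by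
    have h1 := hasDerivAt_iff_tendsto_slope_zero.1 (hF 0)
    rw [h0] at h1
    have h2 := h1.eventually (Units.isOpen.mem_nhds (isUnit_one (M := A)))
    obtain ⟨ε, hu, hne⟩ := (h2.and self_mem_nhdsWithin).exists
    refine ⟨ε, ?_⟩
    have hF0 : F 0 = 0 := intervalIntegral.integral_same
    rw [zero_add, hF0, sub_zero] at hu
    have hne' : ε ≠ 0 := hne
    have h3 := (hne'.isUnit.map (algebraMap ℝ A)).mul hu
    rwa [← Algebra.smul_def, smul_inv_smul₀ hne'] at h3
  obtain ⟨P, hP⟩ := hε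
  -- `m t * F ε` is the integral of `m` over `[t, t + ε]`; dividing by `F ε` expresses `m` through
  -- its differentiable primitive.
  have hmP : ∀ t, m t = (F (t + ε) - F t) * (↑P⁻¹ : A) := fun t => by
    rw [Units.eq_mul_inv_iff_mul_eq, hP]
    simp only [F]
    rw [intervalIntegral.integral_interval_sub_left (hm.intervalIntegrable _ _)
      (hm.intervalIntegrable _ _)]
    have h := (ContinuousLinearMap.mul ℝ A (m t)).intervalIntegral_comp_comm
      (hm.intervalIntegrable (μ := volume) 0 ε)
    simp only [ContinuousLinearMap.mul_apply', ← hadd] at h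
    rw [← h, intervalIntegral.integral_comp_add_left m t, add_zero]
  refine ⟨(m ε - 1) * (↑P⁻¹ : A), fun t => ?_⟩
  have h := (((hF (t + ε)).comp_add_const t ε).sub (hF t)).mul_const (↑P⁻¹ : A)
  rw [← mul_assoc, mul_sub, mul_one, ← hadd]
  exact h.congr_of_eventuallyEq (Filter.Eventually.of_forall hmP)

theorem Polynomial.exists_derivative_eq {K : Type*} [Field K] [CharZero K] (p : Polynomial K) :
    ∃ q : Polynomial K, q.derivative = p := by
  induction p using Polynomial.induction_on' with
  | add p q hp hq =>
    obtain ⟨p', rfl⟩ := hp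
    obtain ⟨q', rfl⟩ := hq
    exact ⟨p' + q', Polynomial.derivative_add⟩
  | monomial n a =>
    refine ⟨Polynomial.monomial (n + 1) (a / (n + 1)), ?_⟩
    rw [Polynomial.derivative_monomial, Nat.add_sub_cancel]
    congr 1
    have : (n : K) + 1 ≠ 0 := Nat.cast_add_one_ne_zero n
    push_cast
    field_simp

section LinearODE

variable {W : Type*} [AddCommGroup W] [Module ℂ W]

/-- Induction on `k`: the derivative of `exp(-μt) U_t v` is `exp(-μt) U_t (D - μ)v`, a polynomial by
the previous case, so `exp(-μt) U_t v` is an antiderivative of it. -/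
theorem exists_polynomial_mul_exp_of_pow_sub_apply_eq_zero {U : ℝ → W → ℂ}
    {D : Module.End ℂ W} (hadd : ∀ t, IsLinearMap ℂ (U t))
    (hU : ∀ v t, HasDerivAt (fun t => U t v) (U t (D v)) t) (μ : ℂ) (k : ℕ) :
    ∀ v, ((D - algebraMap ℂ (Module.End ℂ W) μ) ^ k) v = 0 →
      ∃ p : Polynomial ℂ, ∀ t : ℝ, U t v = p.eval (t : ℂ) * Complex.exp (μ * t) := by
  induction k with
  | zero =>
    intro v hv
    rw [pow_zero, Module.End.one_apply] at hv
    exact ⟨0, fun t => by simp [hv, (hadd t).map_zero]⟩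
  | succ k ih =>
    intro v hv
    obtain ⟨p, hp⟩ := ih ((D - algebraMap ℂ (Module.End ℂ W) μ) v) (by
      rwa [pow_succ, Module.End.mul_apply] at hv)
    obtain ⟨q, rfl⟩ := p.exists_derivative_eq
    have hw : ∀ t, U t (D v) = q.derivative.eval (t : ℂ) * Complex.exp (μ * t) + μ * U t v :=
      fun t => by
        rw [← hp t, LinearMap.sub_apply, (hadd t).map_sub, Module.algebraMap_end_apply,
          (hadd t).map_smul, smul_eq_mul]
        ring
    have hexp : ∀ t : ℝ, HasDerivAt (fun t : ℝ => Complex.exp (-μ * t))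
        (Complex.exp (-μ * t) * (-μ)) t := fun t => by
      have h1 : HasDerivAt (fun z : ℂ => Complex.exp (-μ * z)) (Complex.exp (-μ * t) * (-μ)) t := by
        simpa using ((hasDerivAt_id (t : ℂ)).const_mul (-μ)).cexp
      exact h1.comp_ofReal
    have hr : ∀ t : ℝ, HasDerivAt
        (fun t : ℝ => U t v * Complex.exp (-μ * t) - q.eval (t : ℂ)) 0 t := fun t => by
      have h := ((hU v t).mul (hexp t)).sub (q.hasDerivAt (t : ℂ)).comp_ofReal
      have he : Complex.exp (μ * t) * Complex.exp (-μ * t) = 1 := by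
        rw [← Complex.exp_add, neg_mul, add_neg_cancel, Complex.exp_zero]
      have h0 : U t (D v) * Complex.exp (-μ * t) + U t v * (Complex.exp (-μ * t) * -μ) -
          q.derivative.eval (t : ℂ) = 0 := by
        rw [hw]
        linear_combination q.derivative.eval (t : ℂ) * he
      rw [h0] at h
      exact h
    have hc : ∀ t : ℝ, U t v * Complex.exp (-μ * t) - q.eval (t : ℂ) =
        U 0 v * Complex.exp (-μ * (0 : ℝ)) - q.eval ((0 : ℝ) : ℂ) := fun t =>
      is_const_of_deriv_eq_zero (fun t => (hr t).differentiableAt) (fun t => (hr t).deriv) t 0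
    refine ⟨q + Polynomial.C (U 0 v * Complex.exp (-μ * (0 : ℝ)) - q.eval ((0 : ℝ) : ℂ)),
      fun t => ?_⟩
    rw [Polynomial.eval_add, Polynomial.eval_C, ← hc t, add_sub_cancel, mul_assoc,
      ← Complex.exp_add]
    have : -μ * (t : ℂ) + μ * t = 0 := by ring
    rw [this, Complex.exp_zero, mul_one]

/-- Over `ℂ` the generalized eigenspaces of `D` span `W`, which reduces the claim to a single
generalized eigenvector. -/
theorem isExponentialPolynomial_of_hasDerivAt [FiniteDimensional ℂ W] {d : ℕ} {U : ℝ → W → ℂ}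
    {D : Module.End ℂ W} (hadd : ∀ t, IsLinearMap ℂ (U t))
    (hU : ∀ v t, HasDerivAt (fun t => U t v) (U t (D v)) t) (j : Fin d) (v : W) :
    IsExponentialPolynomial (fun x : EuclideanSpace ℝ (Fin d) => U (x j) v) := by
  have hv : v ∈ ⨆ μ, D.maxGenEigenspace μ := by
    rw [Module.End.iSup_maxGenEigenspace_eq_top]; trivial
  induction hv using Submodule.iSup_induction' with
  | mem μ v hv =>
    obtain ⟨k, hk⟩ := (Module.End.mem_maxGenEigenspace D μ v).1 hv
    obtain ⟨p, hp⟩ := exists_polynomial_mul_exp_of_pow_sub_apply_eq_zero hadd hU μ k v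
      (by rwa [Algebra.algebraMap_eq_smul_one])
    simp only [hp]
    exact .polynomial_mul_exp j p μ
  | zero => simpa [(hadd _).map_zero] using IsExponentialPolynomial.const (d := d) 0
  | add v w _ _ hv hw => simpa [(hadd _).map_add] using hv.add hw

end LinearODE

/-! ### Finite-dimensional continuous representations of `ℝ^d` -/

section Representation

variable {d : ℕ}

local notation "V" => EuclideanSpace ℝ (Fin d)

attribute [local instance] Matrix.linftyOpNormedRing Matrix.linftyOpNormedAlgebra

theorem isExponentialPolynomial_oneParameter_entry {N : ℕ}
    {m : ℝ → Matrix (Fin N) (Fin N) ℂ} (hm : ∀ i k, Continuous fun t => m t i k)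
    (h0 : m 0 = 1) (hadd : ∀ s t, m (s + t) = m s * m t) (j : Fin d) (i k : Fin N) :
    IsExponentialPolynomial (fun x : V => m (x j) i k) := by
  have hc : Continuous m := by
    have : m = fun t => ∑ i, ∑ k, m t i k • Matrix.single i k (1 : ℂ) := by
      ext1 t
      conv_lhs => rw [Matrix.matrix_eq_sum_single (m t)]
      simp [Matrix.smul_single]
    rw [this]
    exact continuous_finsetSum _ fun i _ => continuous_finsetSum _ fun k _ =>
      (hm i k).smul continuous_const
  obtain ⟨a, ha⟩ := exists_hasDerivAt_of_continuous_oneParameter hc h0 hadd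
  let L : (Fin N → ℂ) → Matrix (Fin N) (Fin N) ℂ →ₗ[ℝ] ℂ := fun v =>
    { toFun := fun A => (A.mulVec v) i
      map_add' := fun A B => by simp [Matrix.add_mulVec]
      map_smul' := fun c A => by simp [Matrix.smul_mulVec] }
  have key := isExponentialPolynomial_of_hasDerivAt (d := d) (U := fun t v => (m t).mulVec v i)
    (D := Matrix.toLin' a)
    (fun t => ⟨fun v w => by simp [Matrix.mulVec_add], fun c v => by simp [Matrix.mulVec_smul]⟩)
    (fun v t => by
      have h1 := (LinearMap.toContinuousLinearMap (L v)).hasFDerivAt.comp_hasDerivAt t (ha t)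
      have h2 : (L v) (m t * a) = (m t).mulVec (Matrix.toLin' a v) i := by
        simp [L, Matrix.mulVec_mulVec]
      rw [← h2]
      exact h1) j (Pi.single k 1)
  simpa using key

/-- The matrix coefficients of a continuous matrix representation of `ℝ^d` are exponential
polynomials. -/
theorem isExponentialPolynomial_matrix_entry {N : ℕ} {M : V → Matrix (Fin N) (Fin N) ℂ}
    (hM : ∀ i k, Continuous fun x => M x i k) (h0 : M 0 = 1)
    (hadd : ∀ x y, M (x + y) = M x * M y) (i k : Fin N) :
    IsExponentialPolynomial (fun x => M x i k) := by
  classical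
  -- `M x` is the product of the one-parameter groups `M (x_j e_j)`, so its entries are sums of
  -- products of their entries.
  have key : ∀ (s : Finset (Fin d)) (i k : Fin N), IsExponentialPolynomial
      (fun x : V => M (∑ j ∈ s, x j • EuclideanSpace.single j (1 : ℝ)) i k) := fun s => by
    induction s using Finset.induction_on with
    | empty => intro i k; simpa [h0] using IsExponentialPolynomial.const (d := d) _
    | insert j s hj ih =>
      intro i k
      simp only [Finset.sum_insert hj, hadd, Matrix.mul_apply]
      refine IsExponentialPolynomial.sum _ fun l _ => .mul ?_ (ih l k)
      exact isExponentialPolynomial_oneParameter_entry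
        (m := fun t => M (t • EuclideanSpace.single j (1 : ℝ)))
        (fun i k => (hM i k).comp (continuous_id.smul continuous_const)) (by simp [h0])
        (fun s t => by rw [add_smul, hadd]) j i l
  have hx : ∀ x : V, ∑ j, x j • EuclideanSpace.single j (1 : ℝ) = x := fun x => by
    ext l
    simp [Pi.single_apply]
  simpa only [hx] using key Finset.univ i k

theorem isExponentialPolynomial_matrixCoefficient {W : Type*} [AddCommGroup W] [Module ℂ W]
    [FiniteDimensional ℂ W] {U : V → Module.End ℂ W} (h0 : U 0 = 1)
    (hadd : ∀ x y, U (x + y) = U x * U y)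
    (hc : ∀ (ℓ : Module.Dual ℂ W) (v : W), Continuous fun x => ℓ (U x v))
    (ℓ : Module.Dual ℂ W) (v : W) : IsExponentialPolynomial (fun x => ℓ (U x v)) := by
  let b := Module.finBasis ℂ W
  have hM := isExponentialPolynomial_matrix_entry (M := fun x => LinearMap.toMatrix b b (U x))
    (fun i k => by simpa [LinearMap.toMatrix_apply] using hc (b.coord i) (b k))
    (by simp [h0]) (fun x y => by rw [hadd, LinearMap.toMatrix_mul])
  have : ∀ x, ℓ (U x v) = ∑ i, ∑ k, LinearMap.toMatrix b b (U x) i k * (b.repr v k * ℓ (b i)) :=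
    fun x => by
      conv_lhs => rw [← b.sum_repr (U x v), ← LinearMap.toMatrix_mulVec_repr b b]
      simp [Matrix.mulVec, dotProduct, Finset.sum_mul, mul_assoc]
  simp only [this]
  exact .sum _ fun i _ => .sum _ fun k _ => (hM i k).mul (.const _)

end Representation

/-! ### Commuting operators with a common algebraic vector -/

/-- A vector annihilated by a nonzero polynomial in each of finitely many commuting operators lies
in a finite-dimensional subspace invariant under these operators. -/
theorem exists_finiteDimensional_invariant {K Y ι : Type*} [Field K] [AddCommGroup Y] [Module K Y]
    [Finite ι] (T : ι → Module.End K Y) (hT : ∀ i j, T i * T j = T j * T i) (f : Y)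
    (hf : ∀ i, ∃ P : Polynomial K, P ≠ 0 ∧ Polynomial.aeval (T i) P f = 0) :
    ∃ W : Submodule K Y, FiniteDimensional K W ∧ f ∈ W ∧ ∀ i, ∀ w ∈ W, T i w ∈ W := by
  let C := Algebra.adjoin K (Set.range T)
  have hC : IsMulCommutative C := Algebra.isMulCommutative_adjoin K (by
    rintro _ ⟨i, rfl⟩ _ ⟨j, rfl⟩; exact hT i j)
  let : CommRing C := { (inferInstance : Ring C) with mul_comm := hC.is_comm.comm }
  let t : ι → C := fun i => ⟨T i, Algebra.subset_adjoin ⟨i, rfl⟩⟩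
  let ev : C →ₗ[K] Y := (LinearMap.applyₗ f).comp C.val.toLinearMap
  -- The annihilator of `f`: the quotient `C ⧸ I` is isomorphic to the orbit `C f`, the required
  -- invariant subspace.
  let I : Ideal C :=
    { carrier := {c | ev c = 0}
      add_mem' := fun {a b} ha hb => by
        change ev (a + b) = 0
        rw [map_add, show ev a = 0 from ha, show ev b = 0 from hb, add_zero]
      zero_mem' := map_zero ev
      smul_mem' := fun a b hb => by
        change (a : Module.End K Y) (ev b) = 0
        rw [show ev b = 0 from hb, map_zero] }
  have htop : Algebra.adjoin K (Set.range fun i => Ideal.Quotient.mkₐ K I (t i)) = ⊤ := by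
    have h1 : Algebra.adjoin K (Set.range t) = ⊤ := by
      have h2 : Set.range t = (Subtype.val ⁻¹' Set.range T : Set C) := by
        ext c
        simp only [Set.mem_range, Set.mem_preimage, t, Subtype.ext_iff]
      rw [h2]
      exact Algebra.adjoin_adjoin_coe_preimage
    have h3 : (Set.range fun i => Ideal.Quotient.mkₐ K I (t i)) =
        Ideal.Quotient.mkₐ K I '' Set.range t := by
      rw [← Set.range_comp]; rfl
    rw [h3, ← AlgHom.map_adjoin, h1, Algebra.map_top, AlgHom.range_eq_top]
    exact Ideal.Quotient.mkₐ_surjective K I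
  -- `P_i(T_i) f = 0` makes the class of `T_i` algebraic, and a commutative algebra generated by
  -- finitely many integral elements is a finite module.
  have hfin : Module.Finite K (C ⧸ I) := by
    have := fg_adjoin_of_finite (R := K) (Set.finite_range fun i => Ideal.Quotient.mkₐ K I (t i)) (by
      rintro _ ⟨i, rfl⟩
      obtain ⟨P, hP, hPf⟩ := hf i
      refine IsAlgebraic.isIntegral ⟨P, hP, ?_⟩
      rw [Polynomial.aeval_algHom_apply]
      refine Ideal.Quotient.eq_zero_iff_mem.2 ?_
      change C.val (Polynomial.aeval (t i) P) f = 0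
      rw [← Polynomial.aeval_algHom_apply]
      exact hPf)
    rw [htop] at this
    exact ⟨this⟩
  let ev' : (C ⧸ I) →ₗ[K] Y := (I.restrictScalars K).liftQ ev (fun c hc => hc)
  have hev : ∀ c, ev' (Ideal.Quotient.mkₐ K I c) = ev c := fun c => rfl
  refine ⟨LinearMap.range ev', inferInstance, ⟨Ideal.Quotient.mkₐ K I 1, rfl⟩, ?_⟩
  rintro i _ ⟨c, rfl⟩
  obtain ⟨c, rfl⟩ := Ideal.Quotient.mkₐ_surjective K I c
  exact ⟨Ideal.Quotient.mkₐ K I (t i * c), rfl⟩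

/-! ### Spaces of translates and approximate identities -/

section Translation

variable {d : ℕ}

local notation "V" => EuclideanSpace ℝ (Fin d)

/-- Translation of arbitrary functionals on test functions. -/
noncomputable def functionalTranslate (h : V) : Module.End ℂ (𝓓((⊤ : Opens V), ℝ) → ℂ) :=
  LinearMap.funLeft ℂ ℂ (translateTest h)

theorem functionalTranslate_apply (h : V) (T : 𝓓((⊤ : Opens V), ℝ) → ℂ)
    (φ : 𝓓((⊤ : Opens V), ℝ)) : functionalTranslate h T φ = T (translateTest h φ) := rfl

theorem translateTest_zero (φ : 𝓓((⊤ : Opens V), ℝ)) : translateTest 0 φ = φ := by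
  ext x
  simp [translateTest_apply]

theorem translateTest_translateTest (x y : V) (φ : 𝓓((⊤ : Opens V), ℝ)) :
    translateTest x (translateTest y φ) = translateTest (x + y) φ := by
  ext z
  simp [translateTest_apply, sub_sub]

theorem functionalTranslate_zero : functionalTranslate (0 : V) = 1 := by
  ext T φ
  simp [functionalTranslate_apply, translateTest_zero]

theorem functionalTranslate_add (x y : V) :
    functionalTranslate (x + y) = functionalTranslate x * functionalTranslate y := by
  ext T φ
  simp [functionalTranslate_apply, translateTest_translateTest, add_comm]

theorem functionalTranslate_pow_distribution (h : V) (f : 𝓓'((⊤ : Opens V), ℂ)) (k : ℕ) :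
    (functionalTranslate h ^ k) (f : 𝓓((⊤ : Opens V), ℝ) → ℂ) = (distTranslate h)^[k] f := by
  induction k with
  | zero => rfl
  | succ k ih =>
    rw [pow_succ', Module.End.mul_apply, ih, Function.iterate_succ_apply']
    rfl

theorem exists_polynomial_functionalTranslate_eq_zero (h : V) (f : 𝓓'((⊤ : Opens V), ℂ)) (n : ℕ)
    (hf : Module.finrank ℂ (Submodule.span ℂ {T : 𝓓'((⊤ : Opens V), ℂ) |
        ∃ k : ℕ, k ≤ n ∧ T = (distTranslate h)^[k] f}) ≤ n) :
    ∃ P : Polynomial ℂ, P ≠ 0 ∧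
      Polynomial.aeval (functionalTranslate h) P (f : 𝓓((⊤ : Opens V), ℝ) → ℂ) = 0 := by
  have hset : {T : 𝓓'((⊤ : Opens V), ℂ) | ∃ k : ℕ, k ≤ n ∧ T = (distTranslate h)^[k] f} =
      Set.range fun k : Fin (n + 1) => (distTranslate h)^[k] f := by
    ext T
    constructor
    · rintro ⟨k, hk, rfl⟩
      exact ⟨⟨k, Nat.lt_succ_of_le hk⟩, rfl⟩
    · rintro ⟨k, rfl⟩
      exact ⟨k, Nat.le_of_lt_succ k.2, rfl⟩
  rw [hset] at hf
  -- There are `n + 1` iterates, counted with repetition, in a space of dimension at most `n`.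
  have hdep : ¬ LinearIndependent ℂ fun k : Fin (n + 1) => (distTranslate h)^[k] f := fun hli => by
    rw [finrank_span_eq_card hli, Fintype.card_fin] at hf
    omega
  obtain ⟨c, hc, i, hi⟩ := Fintype.not_linearIndependent_iff.1 hdep
  refine ⟨∑ k : Fin (n + 1), Polynomial.monomial k (c k), fun h0 => hi ?_, ?_⟩
  · have := congrArg (fun P => Polynomial.coeff P i) h0
    simpa [Polynomial.finsetSum_coeff, Polynomial.coeff_monomial, Fin.val_inj] using this
  · ext φ
    have h1 := DFunLike.congr_fun hc φ
    rw [map_sum, LinearMap.sum_apply, Finset.sum_apply]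
    simp only [Polynomial.aeval_monomial, Module.End.mul_apply, Module.algebraMap_end_apply,
      functionalTranslate_pow_distribution]
    refine Eq.trans ?_ h1
    let evφ : 𝓓'((⊤ : Opens V), ℂ) →+ ℂ :=
      { toFun := fun T => T φ, map_zero' := rfl, map_add' := fun _ _ => rfl }
    exact (map_sum evφ (fun k : Fin (n + 1) => c k • (distTranslate h)^[k] f) Finset.univ).symm

/-- If `f` satisfies a difference equation in each of finitely many directions generating a dense
subgroup, then its translates by all vectors span a finite-dimensional space. -/
theorem finiteDimensional_span_functionalTranslate {ι : Type*} [Finite ι] (h : ι → V)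
    (hdense : Dense (AddSubgroup.closure (Set.range h) : Set V))
    (f : 𝓓((⊤ : Opens V), ℝ) → ℂ) (hc : ∀ φ, Continuous fun x => f (translateTest x φ))
    (hf : ∀ i, ∃ P : Polynomial ℂ, P ≠ 0 ∧
      Polynomial.aeval (functionalTranslate (h i)) P f = 0) :
    FiniteDimensional ℂ (Submodule.span ℂ (Set.range fun x => functionalTranslate x f)) := by
  obtain ⟨W, hW, hfW, hinv⟩ := exists_finiteDimensional_invariant
    (fun i => functionalTranslate (h i)) (fun i j => by
      rw [← functionalTranslate_add, add_comm, functionalTranslate_add]) f hf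
  have hneg : ∀ x, (∀ w ∈ W, functionalTranslate x w ∈ W) →
      ∀ w ∈ W, functionalTranslate (-x) w ∈ W := fun x hx w hw => by
    -- An injective endomorphism of the finite-dimensional `W` is onto, so the inverse translation
    -- also preserves `W`.
    have hinj : Function.Injective ((functionalTranslate x).restrict hx) := fun a b hab => by
      have h1 := congrArg (fun w : W => functionalTranslate (-x) (w : _ → ℂ)) hab
      simp only [LinearMap.coe_restrict_apply, ← Module.End.mul_apply, ← functionalTranslate_add,
        neg_add_cancel, functionalTranslate_zero, Module.End.one_apply] at h1
      exact Subtype.ext h1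
    obtain ⟨v, hv⟩ := LinearMap.surjective_of_injective hinj ⟨w, hw⟩
    have h2 : functionalTranslate x (v : _ → ℂ) = w := congrArg Subtype.val hv
    rw [← h2, ← Module.End.mul_apply, ← functionalTranslate_add, neg_add_cancel,
      functionalTranslate_zero]
    exact v.2
  have hG : ∀ x ∈ AddSubgroup.closure (Set.range h), ∀ w ∈ W, functionalTranslate x w ∈ W := by
    intro x hx
    induction hx using AddSubgroup.closure_induction with
    | mem x hx => obtain ⟨i, rfl⟩ := hx; exact hinv i
    | zero => intro w hw; rwa [functionalTranslate_zero]
    | add x y _ _ hx hy =>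
      intro w hw
      rw [functionalTranslate_add]
      exact hx _ (hy w hw)
    | neg x _ hx => exact hneg x hx
  -- Functionals carry the topology of pointwise convergence, in which finite-dimensional subspaces
  -- are closed.
  have hclosed : IsClosed {x : V | functionalTranslate x f ∈ W} :=
    W.closed_of_finiteDimensional.preimage (continuous_pi hc)
  have hall : ∀ x, functionalTranslate x f ∈ W := fun x =>
    closure_minimal (fun x hx => hG x hx f hfW) hclosed (hdense x)
  have hle : Submodule.span ℂ (Set.range fun x => functionalTranslate x f) ≤ W :=
    Submodule.span_le.2 (by rintro _ ⟨x, rfl⟩; exact hall x)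
  exact Submodule.finiteDimensional_of_le hle

/-- The matrix coefficients of the translation action on a finite-dimensional space spanned by
translates are continuous exponential polynomials. -/
theorem exists_finiteDimensional_matrixCoefficient (f : 𝓓((⊤ : Opens V), ℝ) → ℂ)
    (hc : ∀ φ, Continuous fun x => f (translateTest x φ))
    [hfin : FiniteDimensional ℂ (Submodule.span ℂ (Set.range fun x => functionalTranslate x f))] :
    ∃ G : Submodule ℂ (V → ℂ), FiniteDimensional ℂ G ∧
      (∀ g ∈ G, IsExponentialPolynomial g ∧ Continuous g) ∧
      ∀ φ, (fun x => f (translateTest x φ)) ∈ G := by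
  set W := Submodule.span ℂ (Set.range fun x => functionalTranslate x f) with hWdef
  have hinv : ∀ x, ∀ w ∈ W, functionalTranslate x w ∈ W := fun x w hw => by
    have : W.map (functionalTranslate x) ≤ W := by
      rw [hWdef, Submodule.map_span_le]
      rintro _ ⟨y, rfl⟩
      rw [← Module.End.mul_apply, ← functionalTranslate_add]
      exact Submodule.subset_span ⟨x + y, rfl⟩
    exact this ⟨w, hw, rfl⟩
  let U : V → Module.End ℂ W := fun x => (functionalTranslate x).restrict (hinv x)
  have hcW : ∀ w ∈ W, ∀ φ, Continuous fun x => functionalTranslate x w φ := fun w hw φ => by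
    induction hw using Submodule.span_induction with
    | mem w hw =>
      obtain ⟨y, rfl⟩ := hw
      simp only [functionalTranslate_apply, translateTest_translateTest]
      exact (hc φ).comp (continuous_const.add continuous_id)
    | zero => simpa using continuous_const
    | add v w _ _ hv hw => simpa only [map_add, Pi.add_apply] using hv.fun_add hw
    | smul c w _ hw =>
      simp only [map_smul, Pi.smul_apply, smul_eq_mul]
      exact continuous_const.mul hw
  have hcont : ∀ (ℓ : Module.Dual ℂ W) (w : W), Continuous fun x => ℓ (U x w) := fun ℓ w =>
    (LinearMap.continuous_of_finiteDimensional ℓ).comp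
      ((continuous_pi (hcW w w.2)).subtype_mk _)
  let v : W := ⟨f, Submodule.subset_span ⟨0, by
    simp [functionalTranslate_zero]⟩⟩
  let Φ : Module.Dual ℂ W →ₗ[ℂ] (V → ℂ) :=
    { toFun := fun ℓ x => ℓ (U x v)
      map_add' := fun _ _ => rfl
      map_smul' := fun _ _ => rfl }
  -- The range is finite-dimensional because the dual of `W` is; evaluation at `φ` is the dual
  -- vector whose coefficient is `x ↦ f(φ(· - x))`.
  refine ⟨LinearMap.range Φ, inferInstance, ?_, fun φ =>
    ⟨(LinearMap.proj φ).comp W.subtype, rfl⟩⟩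
  rintro _ ⟨ℓ, rfl⟩
  refine ⟨isExponentialPolynomial_matrixCoefficient (U := U) ?_ ?_ hcont ℓ v, hcont ℓ v⟩
  · ext w : 2
    simp [U, functionalTranslate_zero]
  · intro x y
    ext w : 2
    simp [U, functionalTranslate_add]

/-- There is a sequence of test functions that is an approximate identity. -/
theorem exists_tendsto_integral_testFunction_mul :
    ∃ φ : ℕ → 𝓓((⊤ : Opens V), ℝ), ∀ F : V → ℂ, Continuous F →
      Filter.Tendsto (fun n => ∫ x, (φ n x : ℂ) * F x) Filter.atTop (nhds (F 0)) := by
  let b : ℕ → ContDiffBump (0 : V) := fun n =>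
    ⟨(1 / ((n : ℝ) + 1)) / 2, 1 / ((n : ℝ) + 1), by positivity, half_lt_self (by positivity)⟩
  let φ : ℕ → 𝓓((⊤ : Opens V), ℝ) := fun n =>
    ⟨(b n).normed volume, (b n).contDiff_normed, (b n).hasCompactSupport_normed,
      fun _ _ => trivial⟩
  refine ⟨φ, fun F hF => ?_⟩
  -- Convolution at `0` reflects its second argument, so the reflected `F` produces the integral of
  -- `φ n` against `F`.
  have hG : Continuous fun x => F (-x) := hF.comp continuous_neg
  have h := ContDiffBump.convolution_tendsto_right (μ := (volume : Measure V)) (φ := b)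
    (g := fun _ x => F (-x)) (k := fun _ => 0) (x₀ := 0) (z₀ := F 0) (l := Filter.atTop)
    tendsto_one_div_add_atTop_nhds_zero_nat
    (Filter.Eventually.of_forall fun _ => hG.aestronglyMeasurable)
    (by
      have h1 : Filter.Tendsto (fun x => F (-x)) (nhds 0) (nhds (F 0)) := by
        simpa using hG.tendsto 0
      exact h1.comp Filter.tendsto_snd)
    tendsto_const_nhds
  refine h.congr fun n => ?_
  rw [convolution_lsmul]
  congr 1
  ext1 x
  rw [zero_sub, neg_neg, Complex.real_smul]
  rfl

end Translation

theorem mainTheorem2 {d s : ℕ} (h : Fin s → EuclideanSpace ℝ (Fin d))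
    (hdense : Dense (AddSubgroup.closure (Set.range h) : Set (EuclideanSpace ℝ (Fin d))))
    (f : 𝓓'((⊤ : Opens (EuclideanSpace ℝ (Fin d))), ℂ))
    (n : Fin s → ℕ)
    (hf : ∀ i, Module.finrank ℂ
      (Submodule.span ℂ {T : 𝓓'((⊤ : Opens (EuclideanSpace ℝ (Fin d))), ℂ) |
        ∃ k : ℕ, k ≤ n i ∧ T = (distTranslate (h i))^[k] f}) ≤ n i) :
    ∃ g : EuclideanSpace ℝ (Fin d) → ℂ,
      IsExponentialPolynomial g ∧ Continuous g ∧ IsGivenByFunction f g ∧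
        ∀ u : EuclideanSpace ℝ (Fin d) → ℂ, IsGivenByFunction f u → u =ᵐ[volume] g := by
  have hc := continuous_distribution_translateTest f
  have hfin := finiteDimensional_span_functionalTranslate h hdense f hc
    fun i => exists_polynomial_functionalTranslate_eq_zero (h i) f (n i) (hf i)
  obtain ⟨G, hGfin, hG, hmem⟩ := exists_finiteDimensional_matrixCoefficient f hc
  have hint : ∀ (ψ : 𝓓((⊤ : Opens (EuclideanSpace ℝ (Fin d))), ℝ)) (g : G),
      Integrable fun x => (ψ x : ℂ) * (g : EuclideanSpace ℝ (Fin d) → ℂ) x := fun ψ g =>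
    ((Complex.continuous_ofReal.comp ψ.continuous).mul
      (hG g g.2).2).integrable_of_hasCompactSupport
      (ψ.hasCompactSupport.comp_left Complex.ofReal_zero).mul_right
  let I : G →ₗ[ℂ] (𝓓((⊤ : Opens (EuclideanSpace ℝ (Fin d))), ℝ) → ℂ) :=
    { toFun := fun g ψ => ∫ x, (ψ x : ℂ) * (g : EuclideanSpace ℝ (Fin d) → ℂ) x
      map_add' := fun g₁ g₂ => by
        ext1 ψ
        simp only [Submodule.coe_add, Pi.add_apply, mul_add]
        exact integral_add (hint ψ g₁) (hint ψ g₂)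
      map_smul' := fun c g => by
        ext1 ψ
        simp only [Submodule.coe_smul, Pi.smul_apply, smul_eq_mul, RingHom.id_apply,
          mul_left_comm _ c]
        exact integral_const_mul c _ }
  have hclosed := (LinearMap.range I).closed_of_finiteDimensional
  obtain ⟨φ, hφ⟩ := exists_tendsto_integral_testFunction_mul (d := d)
  -- Symmetry of convolution turns `∫ ψ(x) f(φ_k(· - x)) dx` into `∫ φ_k(x) f(ψ(· - x)) dx`, which
  -- tends to the value at `x = 0`, namely `f ψ`.
  have hlim : Filter.Tendsto (fun k => I ⟨_, hmem (φ k)⟩) Filter.atTop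
      (nhds (f : 𝓓((⊤ : Opens (EuclideanSpace ℝ (Fin d))), ℝ) → ℂ)) := by
    refine tendsto_pi_nhds.2 fun ψ => ?_
    have h1 := hφ _ (hc ψ)
    rw [translateTest_zero] at h1
    refine h1.congr fun k => ?_
    rw [integral_mul_distribution_translateTest, convTest_comm]
    exact (integral_mul_distribution_translateTest f ψ (φ k)).symm
  obtain ⟨g, hg⟩ := hclosed.mem_of_tendsto hlim (Filter.Eventually.of_forall fun k => ⟨_, rfl⟩)
  have hfg : IsGivenByFunction f g :=
    ⟨(hG g g.2).2.locallyIntegrable, fun ψ => (congrFun hg ψ).symm⟩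
  refine ⟨g, (hG g g.2).1, (hG g g.2).2, hfg, fun u hu => ?_⟩
  refine ae_eq_of_integral_contDiff_smul_eq hu.1 hfg.1 fun ψ hψ hψc => ?_
  let ψ' : 𝓓((⊤ : Opens (EuclideanSpace ℝ (Fin d))), ℝ) := ⟨ψ, hψ, hψc, fun _ _ => trivial⟩
  simp only [Complex.real_smul]
  exact (hu.2 ψ').symm.trans (hfg.2 ψ')
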